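/- Let $1\le k\le n$ be integers, let $F$ be a finite field with $|F|\ge 2n$, and write $[n]=\{1,\dots,n\}$. Then there are $2n$ distinct elements $\lambda_{i,j}$ ($i\in[n]$, $j\in\{0,1\}$) of $F$, and for every such choice the following holds. Let $\mathcal C$ be the array code of length $n$ over $F$ whose words are the $(C_1,\dots,C_n)$, with nodes $C_i=(c_{i,b,a}: b\in\{1,2,3\},\ a=(a_1,\dots,a_n)\in\{0,1\}^n)\in F^{l}$, that satisfy $$\sum_{i=1}^n \lambda_{i,a_i}^t\, c_{i,b,a}=0\qquad\text{for all } t\in\{0,1,\dots,n-k-1\},\ b\in\{1,2,3\},\ a\in\{0,1\}^n .$$ 1. The node size is $l=3\cdot 2^n$, and $\mathcal C$ consists of three replicas of the Ye--Barg code: a word belongs to $\mathcal C$ if and only if for each $b$ the word $(c_{i,b,a})_{i,a}$ belongs to the code of node size $2^n$ defined by $\sum_{i}\lambda_{i,a_i}^t c_{i,a}=0$ for all $0\le t\le n-k-1$ and all $a\in\{0,1\}^n$. 2. $\mathcal C$ is a $(2,k+1)$-MSR code under the cooperative model. That is, $\mathcal C$ is an $(n,k,l)$ MDS array code (it has $|F|^{kl}$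 words, and the contents of any $k$ nodes determine the word), and for all disjoint $\mathcal F,\mathcal R\subseteq[n]$ with $|\mathcal F|=2$ and $|\mathcal R|=k+1$, the nodes in $\mathcal F$ can be repaired from the nodes in $\mathcal R$ and the smallest possible repair bandwidth meets the cooperative cut-set bound: $$N_{\mathrm{co}}(\mathcal C,\mathcal F,\mathcal R)=\frac{|\mathcal F|\,(|\mathcal R|+|\mathcal F|-1)\,l}{|\mathcal F|+|\mathcal R|-k}=2(k+2)2^n .$$ This bandwidth is attained by a scheme with two rounds. Here a cooperative repair scheme has a finite number of rounds. In each round every helper node in $\mathcal R$ sends to every failed node in $\mathcal F$ a fixed number (possibly zero) of symbols of $F$ that are a function of its own contents, and every failed node sends to every other failed node a fixed number (possibly zero) of symbols that are a function of what it received in earlier rounds; at the end each failed node must be able to recover its contents from what it received. The functions need not be linear. The bandwidth is the total number of symbols sent to the failed nodes, from helper nodes and from other failed nodes, in all rounds, and $N_{\mathrm{co}}(\mathcal C,\mathcal F,\mathcal R)$ is the smallest bandwidth of such a scheme. -/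

import Mathlib

namespace CoopMSR

/-- An array code of length `n` over `F`: node `i` of the word `c` is the vector `c i : ι → F`.
`Fintype.card ι` is the node size.  `IsMDS C k` says that `C` has `k` information nodes, that is
`|F| ^ (k * l)` codewords, and that the contents of any `k` nodes determine the codeword. -/
def IsMDS {n : ℕ} {ι F : Type*} [Fintype ι] (C : Set (Fin n → ι → F)) (k : ℕ) : Prop :=
  Nat.card C = Nat.card F ^ (k * Fintype.card ι) ∧
    ∀ S : Finset (Fin n), S.card = k →
      ∀ c ∈ C, ∀ c' ∈ C, (∀ i ∈ S, c i = c' i) → c = c'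

/-- A scheme with `T` rounds of communication for the cooperative repair of the failed nodes `𝓕`
from the helper nodes `𝓡`.  In round `t`, node `i` (a helper node or a failed node) sends to the
failed node `j` a message of `len t i j` symbols of `F`; `msg t i j c` is that message when the
stored codeword is `c`.  The maps are arbitrary, not necessarily linear.
`Function.FactorsThrough g f` means that `g` is a function of `f`. -/
structure RepairScheme {n : ℕ} {ι F : Type*} (C : Set (Fin n → ι → F))
    (𝓕 𝓡 : Finset (Fin n)) (T : ℕ) where
  /-- number of symbols sent in round `t` from node `i` to node `j` -/
  len : Fin T → Fin n → Fin n → ℕ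
  /-- the message sent in round `t` from node `i` to node `j` -/
  msg : ∀ (t : Fin T) (i j : Fin n), C → (Fin (len t i j) → F)
  /-- what a helper node sends is a function of its own contents -/
  helper_local : ∀ t, ∀ i ∈ 𝓡, ∀ j ∈ 𝓕,
    Function.FactorsThrough (msg t i j) (fun c : C => c.1 i)
  /-- what a failed node sends in round `t` is a function of what it has received, from the
  helper nodes and from the other failed nodes, in the rounds before `t` -/
  failed_causal : ∀ t, ∀ i ∈ 𝓕, ∀ j ∈ 𝓕, i ≠ j →
    Function.FactorsThrough (msg t i j)
      (fun (c : C) (s : {s : Fin T // s < t}) (m : {m // m ∈ (𝓡 ∪ 𝓕).erase i}) =>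
        msg s.1 m.1 i c)
  /-- at the end, every failed node recovers its contents from all that it has received -/
  recover : ∀ j ∈ 𝓕,
    Function.FactorsThrough (fun c : C => c.1 j)
      (fun (c : C) (s : Fin T) (m : {m // m ∈ (𝓡 ∪ 𝓕).erase j}) => msg s m.1 j c)

/-- The total number of symbols of `F` that all failed nodes download in all rounds, from helper
nodes and from other failed nodes. -/
def RepairScheme.bandwidth {n : ℕ} {ι F : Type*} {C : Set (Fin n → ι → F)}
    {𝓕 𝓡 : Finset (Fin n)} {T : ℕ} (S : RepairScheme C 𝓕 𝓡 T) : ℕ :=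
  ∑ t : Fin T, ∑ j ∈ 𝓕, ∑ i ∈ (𝓡 ∪ 𝓕).erase j, S.len t i j

/-- The bandwidths of all cooperative repair schemes, with any finite number of rounds. -/
def bandwidths {n : ℕ} {ι F : Type*} (C : Set (Fin n → ι → F)) (𝓕 𝓡 : Finset (Fin n)) : Set ℕ :=
  {B | ∃ (T : ℕ) (S : RepairScheme C 𝓕 𝓡 T), S.bandwidth = B}

/-- The cooperative repair bandwidth of `C` for failed nodes `𝓕` and helper nodes `𝓡`: the smallest
number of symbols of `F` with which the failed nodes can be repaired (meaningful when
`bandwidths C 𝓕 𝓡` is nonempty). -/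
noncomputable def Nco {n : ℕ} {ι F : Type*} (C : Set (Fin n → ι → F))
    (𝓕 𝓡 : Finset (Fin n)) : ℕ :=
  sInf (bandwidths C 𝓕 𝓡)

/-- `C` is an `(h, d)`-MSR code with dimension parameter `k` under the cooperative model: it is MDS,
and for any `h` failed nodes and any `d` helper nodes the repair is possible and its smallest
bandwidth is the value of the cooperative cut-set bound. -/
def IsMSR {n : ℕ} {ι F : Type*} [Fintype ι] (C : Set (Fin n → ι → F)) (k h d : ℕ) : Prop :=
  IsMDS C k ∧
    ∀ 𝓕 𝓡 : Finset (Fin n), Disjoint 𝓕 𝓡 → 𝓕.card = h → 𝓡.card = d →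
      (bandwidths C 𝓕 𝓡).Nonempty ∧
      (Nco C 𝓕 𝓡 : ℚ) =
        ((𝓕.card : ℚ) * ((𝓡.card : ℚ) + (𝓕.card : ℚ) - 1) * (Fintype.card ι : ℚ)) /
          ((𝓕.card : ℚ) + (𝓡.card : ℚ) - (k : ℚ))

/-- The Ye–Barg code with node size `2 ^ n`.  The coordinates of a node are indexed by the binary
expansions `a = (a_1, …, a_n)` of the numbers `0, …, 2 ^ n - 1`. -/
def yeBargCode {n : ℕ} {F : Type*} [Field F] (lam : Fin n → Fin 2 → F) (k : ℕ) :
    Submodule F (Fin n → (Fin n → Fin 2) → F) where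
  carrier := {c | ∀ t < n - k, ∀ a : Fin n → Fin 2, ∑ i, lam i (a i) ^ t * c i a = 0}
  zero_mem' := by intro t _ a; simp
  add_mem' := by
    intro x y hx hy t ht a
    simp [mul_add, Finset.sum_add_distrib, hx t ht a, hy t ht a]
  smul_mem' := by
    intro r x hx t ht a
    have h := hx t ht a
    simp only [Pi.smul_apply, smul_eq_mul, mul_left_comm _ r, ← Finset.mul_sum, h, mul_zero]

/-- The code with node size `3 * 2 ^ n`: the words `c` with
`∑ i, lam i (a i) ^ t * c i (b, a) = 0` for all `t ∈ {0, …, n - k - 1}`, all `b` and all `a`. -/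
def code {n : ℕ} {F : Type*} [Field F] (lam : Fin n → Fin 2 → F) (k : ℕ) :
    Submodule F (Fin n → (Fin 3 × (Fin n → Fin 2)) → F) where
  carrier := {c | ∀ t < n - k, ∀ (b : Fin 3) (a : Fin n → Fin 2),
    ∑ i, lam i (a i) ^ t * c i (b, a) = 0}
  zero_mem' := by intro t _ b a; simp
  add_mem' := by
    intro x y hx hy t ht b a
    simp [mul_add, Finset.sum_add_distrib, hx t ht b a, hy t ht b a]
  smul_mem' := by
    intro r x hx t ht b a
    have h := hx t ht b a
    simp only [Pi.smul_apply, smul_eq_mul, mul_left_comm _ r, ← Finset.mul_sum, h, mul_zero]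

end CoopMSR

namespace CoopMSR

/-! Repair: to repair the failed node `j`, add the parity checks of replica 0 at `a` to those of a
partner replica at `flip j a`. Every other node enters only through the sum of its two coordinates,
while `j` has two distinct evaluation points. With `k + 1` sums downloaded, `n - k` unknowns remain
in `n - k` Vandermonde equations (`code_pair_eq_zero`). So `j` learns two replicas, and also the
sums of the other failed node. These go to that node in the second round; it knows its replica 0, so
they reveal its third replica, as the two failed nodes use different partners.

Optimality: for a set of `k` failed and helper nodes, the helper contents and the symbols entering
its failed nodes from outside determine the word, so counting words bounds this traffic
(`cut_bound`). The cuts with one and with two failed nodes, averaged over helpers and combined, give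
the bound. -/

/-- A vector supported on at most `r` distinct evaluation points whose first `r` power moments
vanish is zero. -/
theorem eq_zero_of_sum_pow_mul_eq_zero {F κ : Type*} [Field F] (J : Finset κ) (x v : κ → F)
    (hx : Set.InjOn x J) {r : ℕ} (hr : J.card ≤ r)
    (h : ∀ t < r, ∑ j ∈ J, x j ^ t * v j = 0) : ∀ j ∈ J, v j = 0 := by
  let e := J.equivFin
  have key : (fun m : Fin J.card => v (e.symm m)) = 0 := by
    apply Matrix.eq_zero_of_forall_pow_sum_mul_pow_eq_zero (f := fun m => x (e.symm m))
    · intro m m' hm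
      exact e.symm.injective (Subtype.ext (hx (e.symm m).2 (e.symm m').2 hm))
    · intro t
      have ht := h t (lt_of_lt_of_le t.2 hr)
      rw [← Finset.sum_coe_sort, ← e.symm.sum_comp] at ht
      simpa only [mul_comm] using ht
  intro j hj
  have := congrFun key (e ⟨j, hj⟩)
  simpa using this

theorem lam_injective {n : ℕ} {F : Type*} {lam : Fin n → Fin 2 → F}
    (hlam : Function.Injective (Function.uncurry lam)) {i j : Fin n}
    {x y : Fin 2} (h : lam i x = lam j y) : i = j ∧ x = y :=
  Prod.ext_iff.mp (@hlam (i, x) (j, y) h)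

/-! ### The MDS property and the paired parity checks. -/

section Code

variable {n : ℕ} {F : Type*} [Field F] {lam : Fin n → Fin 2 → F}

/-- A codeword that vanishes on `k` nodes is zero. -/
theorem code_eq_zero (hlam : Function.Injective (Function.uncurry lam)) {k : ℕ}
    {w : Fin n → (Fin 3 × (Fin n → Fin 2)) → F} (hw : w ∈ code lam k)
    (S : Finset (Fin n)) (hS : S.card = k) (h : ∀ i ∈ S, w i = 0) : w = 0 := by
  funext i p
  obtain ⟨b, a⟩ := p
  by_cases hi : i ∈ S
  · exact congrFun (h i hi) (b, a)
  refine eq_zero_of_sum_pow_mul_eq_zero Sᶜ (fun i => lam i (a i)) (fun i => w i (b, a)) ?_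
    (r := n - k) ?_ ?_ i (Finset.mem_compl.mpr hi)
  · intro i _ j _ hij
    exact (lam_injective hlam hij).1
  · rw [Finset.card_compl, hS, Fintype.card_fin]
  · intro t ht
    rw [← hw t ht b a]
    refine Finset.sum_subset (Finset.subset_univ _) fun j _ hj => ?_
    rw [h j (by simpa using hj)]
    simp

/-- The parity-check map of `code lam k`. -/
def parityCheck (lam : Fin n → Fin 2 → F) (k : ℕ) :
    (Fin n → (Fin 3 × (Fin n → Fin 2)) → F) →ₗ[F]
      (Fin (n - k) → (Fin 3 × (Fin n → Fin 2)) → F) where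
  toFun c := fun t p => ∑ i, lam i (p.2 i) ^ (t : ℕ) * c i p
  map_add' x y := by
    funext t p
    simp [mul_add, Finset.sum_add_distrib]
  map_smul' r x := by
    funext t p
    simp [Finset.mul_sum, mul_left_comm]

theorem ker_parityCheck (lam : Fin n → Fin 2 → F) (k : ℕ) :
    LinearMap.ker (parityCheck lam k) = code lam k := by
  ext c
  rw [LinearMap.mem_ker]
  constructor
  · intro h t ht b a
    exact congrFun (congrFun h ⟨t, ht⟩) (b, a)
  · intro h
    funext t p
    exact h t t.2 p.1 p.2

/-- Restriction to `k` nodes is injective, which bounds the dimension above; counting parity checks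
bounds it below. -/
theorem finrank_code (hlam : Function.Injective (Function.uncurry lam)) {k : ℕ} (hkn : k ≤ n) :
    Module.finrank F (code lam k) = k * Fintype.card (Fin 3 × (Fin n → Fin 2)) := by
  apply le_antisymm
  · obtain ⟨S, hS⟩ : ∃ S : Finset (Fin n), S.card = k := by
      obtain ⟨S, -, hS⟩ := Finset.exists_subset_card_eq
        (s := (Finset.univ : Finset (Fin n))) (n := k) (by simpa using hkn)
      exact ⟨S, hS⟩
    let φ : code lam k →ₗ[F] (S → (Fin 3 × (Fin n → Fin 2)) → F) :=
      (LinearMap.funLeft F _ (fun i : S => (i : Fin n))).comp (code lam k).subtype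
    have hφ : Function.Injective φ := by
      rw [← LinearMap.ker_eq_bot, LinearMap.ker_eq_bot']
      intro w hw
      apply Subtype.ext
      exact code_eq_zero hlam w.2 S hS fun i hi => congrFun hw ⟨i, hi⟩
    refine (LinearMap.finrank_le_finrank_of_injective hφ).trans (le_of_eq ?_)
    rw [Module.finrank_pi_fintype]
    simp [hS]
  · have h := (parityCheck lam k).finrank_range_add_finrank_ker
    have h' := Submodule.finrank_le (LinearMap.range (parityCheck lam k))
    rw [ker_parityCheck, Module.finrank_pi_fintype] at h
    rw [Module.finrank_pi_fintype] at h'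
    simp only [Module.finrank_fintype_fun_eq_card, Finset.sum_const, Finset.card_univ,
      Fintype.card_fin, smul_eq_mul] at h h'
    generalize Fintype.card (Fin 3 × (Fin n → Fin 2)) = l at *
    rw [Nat.sub_mul] at h'
    have := Nat.mul_le_mul_right l hkn
    omega

theorem isMDS_code [Fintype F] (hlam : Function.Injective (Function.uncurry lam)) {k : ℕ}
    (hkn : k ≤ n) :
    IsMDS (code lam k : Set (Fin n → (Fin 3 × (Fin n → Fin 2)) → F)) k := by
  constructor
  · rw [← finrank_code hlam hkn]
    exact Module.natCard_eq_pow_finrank (K := F) (V := code lam k)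
  · intro S hS c hc c' hc' h
    exact sub_eq_zero.mp (code_eq_zero hlam (Submodule.sub_mem _ hc hc') S hS
      fun i hi => sub_eq_zero.mpr (h i hi))

/-- Flip the coordinate `i` of `a`. -/
def flip (i : Fin n) (a : Fin n → Fin 2) : Fin n → Fin 2 :=
  Function.update a i (1 - a i)

theorem flip_flip (i : Fin n) (a : Fin n → Fin 2) : flip i (flip i a) = a := by
  simp [flip]

/-- The repair of a single node `j` from sums of two planes that differ in the coordinate `j`: if
`k + 1` helper nodes have vanishing sums, then both coordinates of node `j` vanish, and so do the
sums of all other nodes. -/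
theorem code_pair_eq_zero (hlam : Function.Injective (Function.uncurry lam)) {k : ℕ}
    {w : Fin n → (Fin 3 × (Fin n → Fin 2)) → F} (hw : w ∈ code lam k)
    {𝓡 : Finset (Fin n)} (hR : 𝓡.card = k + 1) {j : Fin n} (hj : j ∉ 𝓡) (b b' : Fin 3)
    (a : Fin n → Fin 2) (h : ∀ i ∈ 𝓡, w i (b, a) + w i (b', flip j a) = 0) :
    w j (b, a) = 0 ∧ w j (b', flip j a) = 0 ∧
      ∀ i, i ≠ j → w i (b, a) + w i (b', flip j a) = 0 := by
  -- `none` carries the second evaluation point of node `j`.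
  let x : Option (Fin n) → F := fun o => o.elim (lam j (flip j a j)) (fun i => lam i (a i))
  let v : Option (Fin n) → F := fun o => o.elim (w j (b', flip j a))
    (fun i => if i = j then w j (b, a) else w i (b, a) + w i (b', flip j a))
  have hne : flip j a j ≠ a j := by
    simp only [flip, Function.update_self]
    generalize a j = y
    revert y
    decide
  have hflip : ∀ i, i ≠ j → flip j a i = a i := fun i hi => by simp [flip, hi]
  have key := eq_zero_of_sum_pow_mul_eq_zero (Finset.insertNone 𝓡ᶜ) x v ?_ (r := n - k) ?_ ?_
  · refine ⟨?_, ?_, fun i hi => ?_⟩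
    · simpa [v] using key (some j) (by simpa using hj)
    · simpa [v] using key none (by simp)
    · by_cases hiR : i ∈ 𝓡
      · exact h i hiR
      · simpa [v, hi] using key (some i) (by simpa using hiR)
  · rintro (_ | i) - (_ | i') - hxy
    · rfl
    · obtain ⟨rfl, h2⟩ := lam_injective hlam hxy
      exact absurd h2 hne
    · obtain ⟨rfl, h2⟩ := lam_injective hlam hxy
      exact absurd h2.symm hne
    · rw [(lam_injective hlam hxy).1]
  -- There are `n - k - 1` nodes outside `𝓡`, and `none` brings the count to exactly `n - k`.
  · have hlt : 𝓡.card < n := by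
      simpa using Finset.card_lt_univ_of_notMem hj
    rw [Finset.card_insertNone, Finset.card_compl, hR, Fintype.card_fin]
    omega
  · intro t ht
    have h1 := hw t ht b a
    have h2 := hw t ht b' (flip j a)
    have h3 : ∑ i ∈ 𝓡ᶜ, x (some i) ^ t * v (some i) = ∑ i, x (some i) ^ t * v (some i) := by
      refine Finset.sum_subset (Finset.subset_univ _) fun i _ hi => ?_
      have hi : i ∈ 𝓡 := by simpa using hi
      have hij : i ≠ j := fun e => hj (e ▸ hi)
      simp [v, hij, h i hi]
    rw [Finset.sum_insertNone, h3, ← Finset.add_sum_erase _ _ (Finset.mem_univ j)]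
    rw [← Finset.add_sum_erase _ _ (Finset.mem_univ j)] at h1 h2
    have h4 : ∑ i ∈ Finset.univ.erase j, x (some i) ^ t * v (some i) =
        ∑ i ∈ Finset.univ.erase j, lam i (a i) ^ t * w i (b, a) +
        ∑ i ∈ Finset.univ.erase j, lam i (flip j a i) ^ t * w i (b', flip j a) := by
      rw [← Finset.sum_add_distrib]
      refine Finset.sum_congr rfl fun i hi => ?_
      have hij := Finset.ne_of_mem_erase hi
      simp [x, v, hij, hflip i hij, mul_add]
    rw [h4]
    simp only [x, v, Option.elim, if_true]
    linear_combination h1 + h2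

end Code

/-! ### The two-round repair scheme. -/

section Scheme

variable {n : ℕ} {F : Type*} [Field F] {lam : Fin n → Fin 2 → F}

/-- The replica that is paired with replica `0` for the repair of node `j`, when `p` is one of the
two failed nodes. -/
def partner (p j : Fin n) : Fin 3 := if j = p then 1 else 2

/-- The sum of the coordinates of node `i` that are paired for the repair of node `j`. -/
def pairSum (p : Fin n) (c : Fin n → (Fin 3 × (Fin n → Fin 2)) → F) (i j : Fin n)
    (a : Fin n → Fin 2) : F :=
  c i (0, a) + c i (partner p j, flip j a)

/-- What node `i` sends to node `j` in round `t`: in round `0`, its own paired sums for the repair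
of `j`; in round `1`, the paired sums of node `j` for the repair of `i`. -/
def payload (p : Fin n) (c : Fin n → (Fin 3 × (Fin n → Fin 2)) → F) (t : Fin 2) (i j : Fin n) :
    (Fin n → Fin 2) → F :=
  if t = 0 then pairSum p c i j else pairSum p c j i

/-- Apply `code_pair_eq_zero` to `c - c'`; since `flip j` is an involution, the whole partner
replica is covered. -/
theorem eq_on_pair (hlam : Function.Injective (Function.uncurry lam)) {k : ℕ}
    {c c' : Fin n → (Fin 3 × (Fin n → Fin 2)) → F} (hc : c ∈ code lam k) (hc' : c' ∈ code lam k)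
    {𝓡 : Finset (Fin n)} (hR : 𝓡.card = k + 1) {j : Fin n} (hj : j ∉ 𝓡) (p : Fin n)
    (h : ∀ i ∈ 𝓡, pairSum p c i j = pairSum p c' i j) :
    (∀ a, c j (0, a) = c' j (0, a)) ∧ (∀ a, c j (partner p j, a) = c' j (partner p j, a)) ∧
      ∀ i, i ≠ j → pairSum p c i j = pairSum p c' i j := by
  have key := fun a => code_pair_eq_zero hlam (Submodule.sub_mem _ hc hc') hR hj 0 (partner p j) a
    fun i hi => by
      have := congrFun (h i hi) a
      simp only [pairSum] at this
      simp only [Pi.sub_apply]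
      linear_combination this
  simp only [Pi.sub_apply] at key
  refine ⟨fun a => sub_eq_zero.mp (key a).1, fun a => ?_, fun i hi => ?_⟩
  · have := (key (flip j a)).2.1
    rw [flip_flip] at this
    exact sub_eq_zero.mp this
  · funext a
    have := (key a).2.2 i hi
    simp only [pairSum]
    linear_combination this

/-- The number of symbols that node `i` sends in round `t`. -/
def schemeLen (𝓡 : Finset (Fin n)) (t : Fin 2) (i : Fin n) : ℕ :=
  -- Helper nodes speak only in round 0, failed nodes only in round 1.
  if (t = 0 ↔ i ∈ 𝓡) then 2 ^ n else 0

theorem schemeLen_le (𝓡 : Finset (Fin n)) (t : Fin 2) (i : Fin n) :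
    schemeLen 𝓡 t i ≤ 2 ^ n := by
  unfold schemeLen
  split_ifs <;> simp

/-- The message that node `i` sends to node `j` in round `t`. -/
def schemeMsg (𝓡 : Finset (Fin n)) (p : Fin n) (t : Fin 2) (i j : Fin n)
    (c : Fin n → (Fin 3 × (Fin n → Fin 2)) → F) : Fin (schemeLen 𝓡 t i) → F :=
  fun x => payload p c t i j (finFunctionFinEquiv.symm (Fin.castLE (schemeLen_le 𝓡 t i) x))

theorem payload_eq {𝓡 : Finset (Fin n)} {p : Fin n} {t : Fin 2} {i j : Fin n}
    {c c' : Fin n → (Fin 3 × (Fin n → Fin 2)) → F} (ht : t = 0 ↔ i ∈ 𝓡)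
    (h : schemeMsg 𝓡 p t i j c = schemeMsg 𝓡 p t i j c') :
    payload p c t i j = payload p c' t i j := by
  have hl : schemeLen 𝓡 t i = 2 ^ n := if_pos ht
  funext a
  have := congrFun h (Fin.cast hl.symm (finFunctionFinEquiv a))
  have hcast : Fin.castLE (schemeLen_le 𝓡 t i) (Fin.cast hl.symm (finFunctionFinEquiv a)) =
      finFunctionFinEquiv a := rfl
  simpa only [schemeMsg, hcast, Equiv.symm_apply_apply] using this

/-- The two-round repair scheme for the failed nodes `p` and `q`. -/
def scheme (hlam : Function.Injective (Function.uncurry lam)) {k : ℕ} {p q : Fin n}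
    (hpq : p ≠ q) {𝓡 : Finset (Fin n)} (hR : 𝓡.card = k + 1)
    (hd : Disjoint ({p, q} : Finset (Fin n)) 𝓡) :
    RepairScheme (code lam k : Set (Fin n → (Fin 3 × (Fin n → Fin 2)) → F)) {p, q} 𝓡 2 where
  len t i _ := schemeLen 𝓡 t i
  msg t i j c := schemeMsg 𝓡 p t i j c.1
  helper_local t i hi j hj c c' h := by
    funext x
    by_cases ht : t = 0
    · have h : c.1 i = c'.1 i := h
      simp [schemeMsg, payload, ht, pairSum, h]
    · have hl : schemeLen 𝓡 t i = 0 := if_neg (by tauto)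
      exact absurd x.2 (by omega)
  failed_causal t i hi j hj hij c c' h := by
    have hiR : i ∉ 𝓡 := Finset.disjoint_left.mp hd hi
    funext x
    by_cases ht : t = 0
    · have hl : schemeLen 𝓡 t i = 0 := if_neg (by tauto)
      exact absurd x.2 (by omega)
    · have key := (eq_on_pair hlam c.2 c'.2 hR hiR p fun m hm => by
        have hmi : m ≠ i := fun e => hiR (e ▸ hm)
        have h0 := congrFun (congrFun h ⟨0, by omega⟩) ⟨m, by simp [hmi, hm]⟩
        simpa [payload] using payload_eq (by simpa using hm) h0).2.2 j hij.symm
      simp [schemeMsg, payload, ht, key]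
  recover j hj c c' h := by
    have hjR : j ∉ 𝓡 := Finset.disjoint_left.mp hd hj
    obtain ⟨h0, h1, -⟩ := eq_on_pair hlam c.2 c'.2 hR hjR p fun m hm => by
      have hmj : m ≠ j := fun e => hjR (e ▸ hm)
      have h0 := congrFun (congrFun h 0) ⟨m, by simp [hmj, hm]⟩
      simpa [payload] using payload_eq (by simpa using hm) h0
    -- The partners of the two failed nodes are 1 and 2, so with 0 they exhaust the replicas.
    obtain ⟨i, hi, hij, hpart⟩ : ∃ i ∈ ({p, q} : Finset (Fin n)), i ≠ j ∧
        ∀ b : Fin 3, b = 0 ∨ b = partner p j ∨ b = partner p i := by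
      rcases Finset.mem_insert.mp hj with rfl | hj
      · exact ⟨q, by simp, hpq.symm, by simp [partner, hpq.symm]; decide⟩
      · obtain rfl := Finset.mem_singleton.mp hj
        exact ⟨p, by simp, hpq, by simp [partner, hpq.symm]; decide⟩
    have hiR : i ∉ 𝓡 := Finset.disjoint_left.mp hd hi
    have h2 : pairSum p c.1 j i = pairSum p c'.1 j i := by
      have h2 := congrFun (congrFun h 1) ⟨i, Finset.mem_erase.mpr
        ⟨hij, Finset.mem_union_right _ hi⟩⟩
      simpa [payload] using payload_eq (by simpa using hiR) h2
    show c.1 j = c'.1 j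
    funext ⟨b, a⟩
    rcases hpart b with rfl | rfl | rfl
    · exact h0 a
    · exact h1 a
    · have := congrFun h2 (flip i a)
      simp only [pairSum, flip_flip, h0] at this
      exact add_left_cancel this

theorem sum_erase_union {M : Type*} [AddCommMonoid M] {p q : Fin n} (hpq : p ≠ q)
    {𝓡 : Finset (Fin n)} (hd : Disjoint ({p, q} : Finset (Fin n)) 𝓡) (f : Fin n → M) :
    ∑ i ∈ (𝓡 ∪ {p, q}).erase p, f i = f q + ∑ i ∈ 𝓡, f i := by
  have hp : p ∉ 𝓡 := Finset.disjoint_left.mp hd (by simp)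
  have hq : q ∉ 𝓡 := Finset.disjoint_left.mp hd (by simp)
  rw [← Finset.sum_insert hq]
  congr 1
  ext i
  simp only [Finset.mem_erase, Finset.mem_union, Finset.mem_insert, Finset.mem_singleton]
  constructor
  · tauto
  · rintro (rfl | h)
    · exact ⟨hpq.symm, by simp⟩
    · exact ⟨fun e => hp (e ▸ h), Or.inl h⟩

theorem sum_sum_erase_union {M : Type*} [AddCommMonoid M] {p q : Fin n} (hpq : p ≠ q)
    {𝓡 : Finset (Fin n)} (hd : Disjoint ({p, q} : Finset (Fin n)) 𝓡) (f : Fin n → Fin n → M) :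
    ∑ j ∈ ({p, q} : Finset (Fin n)), ∑ i ∈ (𝓡 ∪ {p, q}).erase j, f i j =
      (f q p + ∑ i ∈ 𝓡, f i p) + (f p q + ∑ i ∈ 𝓡, f i q) := by
  rw [Finset.sum_pair hpq, sum_erase_union hpq hd, Finset.pair_comm,
    sum_erase_union hpq.symm (by rwa [Finset.pair_comm])]

theorem scheme_bandwidth (hlam : Function.Injective (Function.uncurry lam)) {k : ℕ} {p q : Fin n}
    (hpq : p ≠ q) {𝓡 : Finset (Fin n)} (hR : 𝓡.card = k + 1)
    (hd : Disjoint ({p, q} : Finset (Fin n)) 𝓡) :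
    (scheme hlam hpq hR hd).bandwidth = 2 * (k + 2) * 2 ^ n := by
  have hp : p ∉ 𝓡 := Finset.disjoint_left.mp hd (by simp)
  have hq : q ∉ 𝓡 := Finset.disjoint_left.mp hd (by simp)
  have h0 : ∑ i ∈ 𝓡, schemeLen 𝓡 0 i = (k + 1) * 2 ^ n := by
    rw [← hR, ← smul_eq_mul, ← Finset.sum_const]
    exact Finset.sum_congr rfl fun i hi => if_pos (by simpa using hi)
  have h1 : ∑ i ∈ 𝓡, schemeLen 𝓡 1 i = 0 :=
    Finset.sum_eq_zero fun i hi => if_neg (by simpa using hi)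
  simp only [RepairScheme.bandwidth, scheme, sum_sum_erase_union hpq hd, Fin.sum_univ_two, h0, h1]
  simp only [schemeLen, hp, hq]
  simp
  ring

end Scheme

/-! ### The cut-set lower bound. -/

section CutSet

variable {n : ℕ} {ι F : Type*} {C : Set (Fin n → ι → F)} {k T : ℕ}
  {𝓕 𝓡 : Finset (Fin n)}

/-- The contents of the helper nodes in `H` and what the nodes outside `A ∪ H` send to the failed
nodes in `A` determine everything that the nodes in `A` receive. -/
theorem RepairScheme.msg_eq (S : RepairScheme C 𝓕 𝓡 T) {A H : Finset (Fin n)} (hA : A ⊆ 𝓕)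
    (hH : H ⊆ 𝓡) {c c' : C} (hcH : ∀ i ∈ H, c.1 i = c'.1 i)
    (hmsg : ∀ j ∈ A, ∀ i ∈ (𝓡 ∪ 𝓕) \ (A ∪ H), ∀ t, S.msg t i j c = S.msg t i j c') (t : Fin T) :
    ∀ j ∈ A, ∀ i ∈ (𝓡 ∪ 𝓕).erase j, S.msg t i j c = S.msg t i j c' := by
  -- Messages inside `A` depend only on earlier rounds.
  induction t using WellFoundedLT.induction with
  | ind t ih =>
    intro j hj i hi
    obtain ⟨hij, hi⟩ := Finset.mem_erase.mp hi
    by_cases hiH : i ∈ H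
    · exact S.helper_local t i (hH hiH) j (hA hj) (hcH i hiH)
    by_cases hiA : i ∈ A
    · refine S.failed_causal t i (hA hiA) j (hA hj) hij ?_
      funext s m
      exact ih s.1 s.2 i hiA m.1 m.2
    · exact hmsg j hj i (by simp [hiA, hiH, Finset.mem_union.mp hi]) t

/-- The cut that separates the failed nodes in `A` and the helper nodes in `H` from the rest. -/
theorem RepairScheme.cut_bound [Fintype ι] [Finite F] [Nontrivial F] (S : RepairScheme C 𝓕 𝓡 T)
    (hC : IsMDS C k) (hd : Disjoint 𝓕 𝓡) {A H : Finset (Fin n)} (hA : A ⊆ 𝓕) (hH : H ⊆ 𝓡)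
    (hcard : A.card + H.card = k) :
    A.card * Fintype.card ι ≤
      ∑ j ∈ A, ∑ i ∈ (𝓡 ∪ 𝓕) \ (A ∪ H), ∑ t, S.len t i j := by
  -- The maps need not be linear, so the bound comes from counting the values of an injection.
  let Φ : C → (H → ι → F) × (∀ (j : A) (i : ↥((𝓡 ∪ 𝓕) \ (A ∪ H))) (t : Fin T),
      Fin (S.len t i j) → F) :=
    fun c => (fun i => c.1 i, fun j i t => S.msg t i j c)
  have hΦ : Function.Injective Φ := by
    intro c c' h
    have hcH : ∀ i ∈ H, c.1 i = c'.1 i := fun i hi =>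
      congrFun (congrArg Prod.fst h) ⟨i, hi⟩
    have hmsg := S.msg_eq hA hH hcH fun j hj i hi t =>
      congrFun (congrFun (congrFun (congrArg Prod.snd h) ⟨j, hj⟩) ⟨i, hi⟩) t
    apply Subtype.ext
    refine hC.2 (A ∪ H) ?_ c c.2 c' c'.2 fun i hi => ?_
    · rw [Finset.card_union_of_disjoint (Finset.disjoint_of_subset_left hA
        (Finset.disjoint_of_subset_right hH hd)), hcard]
    · rcases Finset.mem_union.mp hi with hi | hi
      · refine S.recover i (hA hi) ?_
        funext t m
        exact hmsg t i hi m.1 m.2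
      · exact hcH i hi
  have h := Nat.card_le_card_of_injective Φ hΦ
  rw [hC.1, Nat.card_prod] at h
  simp only [Nat.card_pi, Finset.prod_const, Finset.card_univ, Fintype.card_fin,
    Fintype.card_coe, Finset.prod_pow_eq_pow_sum, ← pow_mul, ← pow_add] at h
  rw [pow_le_pow_iff_right₀ Finite.one_lt_card, ← hcard] at h
  have hsum : ∀ j, ∑ i : ↥((𝓡 ∪ 𝓕) \ (A ∪ H)), ∑ t, S.len t i j =
      ∑ i ∈ (𝓡 ∪ 𝓕) \ (A ∪ H), ∑ t, S.len t i j := fun j =>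
    Finset.sum_coe_sort _ (fun i => ∑ t, S.len t i j)
  simp only [hsum] at h
  rw [Finset.sum_coe_sort A (fun j => ∑ i ∈ (𝓡 ∪ 𝓕) \ (A ∪ H), ∑ t, S.len t i j)] at h
  rw [add_mul, mul_comm (Fintype.card ι)] at h
  omega

end CutSet

/-- If every `m`-subset of `R` has `f`-sum at least `L - g`, then so does the average one. -/
theorem card_mul_le_of_forall_subset {κ : Type*} [DecidableEq κ] (f : κ → ℕ) (L g m : ℕ)
    (hm : 1 ≤ m) (R : Finset κ) (hR : m ≤ R.card)
    (h : ∀ X ⊆ R, X.card = m → L ≤ ∑ i ∈ X, f i + g) :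
    R.card * L ≤ m * ∑ i ∈ R, f i + R.card * g := by
  obtain ⟨N, hN⟩ : ∃ N, R.card = N := ⟨_, rfl⟩
  rw [hN] at hR ⊢
  induction N, hR using Nat.le_induction generalizing R with
  | base =>
    have := Nat.mul_le_mul_left m (h R subset_rfl hN)
    rwa [mul_add] at this
  | succ N hmN ih =>
    have key : ∀ x ∈ R, N * L ≤ m * ∑ i ∈ R.erase x, f i + N * g := fun x hx =>
      ih (R.erase x) (fun X hX => h X (hX.trans (Finset.erase_subset _ _)))
        (by rw [Finset.card_erase_of_mem hx, hN]; rfl)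
    have hsum := Finset.sum_le_sum key
    -- Summed over all deletions, each `f i` is counted `N` times.
    have hdouble : ∑ x ∈ R, ∑ i ∈ R.erase x, f i + ∑ x ∈ R, f x = (N + 1) * ∑ x ∈ R, f x := by
      rw [← Finset.sum_add_distrib, Finset.sum_congr rfl fun x hx => Finset.sum_erase_add R f hx]
      simp [hN]
    simp only [Finset.sum_add_distrib, ← Finset.mul_sum, Finset.sum_const, hN, smul_eq_mul] at hsum
    have hdouble' : ∑ x ∈ R, ∑ i ∈ R.erase x, f i = N * ∑ x ∈ R, f x := by linarith
    rw [hdouble'] at hsum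
    refine le_of_mul_le_mul_left (a := N) ?_ (by omega)
    linarith

/-- The cooperative cut-set bound for two failed nodes and `k + 1` helper nodes. -/
theorem RepairScheme.cutSet_bound {n : ℕ} {ι F : Type*} [Fintype ι] [Finite F] [Nontrivial F]
    {C : Set (Fin n → ι → F)} {k T : ℕ} (hk : 1 ≤ k) (hC : IsMDS C k) {p q : Fin n}
    (hpq : p ≠ q) {𝓡 : Finset (Fin n)} (hR : 𝓡.card = k + 1)
    (hd : Disjoint ({p, q} : Finset (Fin n)) 𝓡) (S : RepairScheme C {p, q} 𝓡 T) :
    2 * (k + 2) * Fintype.card ι ≤ 3 * S.bandwidth := by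
  have hp : p ∉ 𝓡 := Finset.disjoint_left.mp hd (by simp)
  have hq : q ∉ 𝓡 := Finset.disjoint_left.mp hd (by simp)
  have hband : S.bandwidth = ∑ j ∈ ({p, q} : Finset (Fin n)),
      ∑ i ∈ (𝓡 ∪ {p, q}).erase j, ∑ t, S.len t i j := by
    unfold RepairScheme.bandwidth
    rw [Finset.sum_comm]
    exact Finset.sum_congr rfl fun j _ => Finset.sum_comm
  rw [sum_sum_erase_union hpq hd] at hband
  -- Here `H = 𝓡 \ X` has `k - 1` nodes, and the other failed node `y` lies across the cut.
  have hone : ∀ x y : Fin n, x ≠ y → ({x, y} : Finset (Fin n)) = {p, q} → ∀ X ⊆ 𝓡, X.card = 2 →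
      Fintype.card ι ≤ ∑ i ∈ X, ∑ t, S.len t i x + ∑ t, S.len t y x := by
    intro x y hxy hset X hX hcard
    have hx : x ∉ 𝓡 := Finset.disjoint_left.mp hd (by simp [← hset])
    have hy : y ∉ 𝓡 := Finset.disjoint_left.mp hd (by simp [← hset])
    have h := S.cut_bound hC hd (A := {x}) (H := 𝓡 \ X) (by simp [← hset])
      Finset.sdiff_subset (by
        rw [Finset.card_sdiff_of_subset hX, hR, hcard, Finset.card_singleton]; omega)
    have hs : (𝓡 ∪ {p, q}) \ ({x} ∪ 𝓡 \ X) = insert y X := by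
      ext i
      rw [← hset]
      simp only [Finset.mem_sdiff, Finset.mem_union, Finset.mem_insert, Finset.mem_singleton]
      constructor
      · tauto
      · rintro (rfl | h)
        · exact ⟨by simp, by simp [hxy.symm, hy]⟩
        · exact ⟨Or.inl (hX h), by
            rintro (h' | h')
            · exact hx (h' ▸ hX h)
            · exact h'.2 h⟩
    rw [hs, Finset.sum_singleton, Finset.sum_insert (fun h => hy (hX h)),
      Finset.card_singleton, one_mul] at h
    omega
  -- Now `H` has `k - 2` nodes, hence `2 ≤ k`; traffic between `p` and `q` does not cross the cut.
  have htwo : 2 ≤ k → ∀ X ⊆ 𝓡, X.card = 3 →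
      2 * Fintype.card ι ≤ ∑ i ∈ X, (∑ t, S.len t i p + ∑ t, S.len t i q) + 0 := by
    intro hk2 X hX hcard
    have h := S.cut_bound hC hd (A := {p, q}) (H := 𝓡 \ X) subset_rfl
      Finset.sdiff_subset (by
        rw [Finset.card_sdiff_of_subset hX, hR, hcard, Finset.card_pair hpq]; omega)
    have hs : (𝓡 ∪ {p, q}) \ ({p, q} ∪ 𝓡 \ X) = X := by
      ext i
      have := @hX i
      have hi : i ∈ ({p, q} : Finset (Fin n)) → i ∉ 𝓡 := fun h => Finset.disjoint_left.mp hd h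
      simp only [Finset.mem_sdiff, Finset.mem_union]
      tauto
    rw [hs, Finset.sum_pair hpq, Finset.card_pair hpq] at h
    rw [Finset.sum_add_distrib]
    omega
  have havg1 := card_mul_le_of_forall_subset
    (fun i => ∑ t, S.len t i p + ∑ t, S.len t i q) (2 * Fintype.card ι)
    (∑ t, S.len t q p + ∑ t, S.len t p q) 2 (by omega) 𝓡 (by omega) fun X hX hcard => by
      have h1 := hone p q hpq rfl X hX hcard
      have h2 := hone q p hpq.symm (Finset.pair_comm q p) X hX hcard
      rw [Finset.sum_add_distrib]
      omega
  have havg2 := fun hk2 : 2 ≤ k => card_mul_le_of_forall_subset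
    (fun i => ∑ t, S.len t i p + ∑ t, S.len t i q) (2 * Fintype.card ι) 0 3 (by omega) 𝓡
    (by omega) (htwo hk2)
  rw [hR, Finset.sum_add_distrib] at havg1 havg2
  rw [hband]
  generalize ∑ i ∈ 𝓡, ∑ t, S.len t i p = B₁ at *
  generalize ∑ i ∈ 𝓡, ∑ t, S.len t i q = B₂ at *
  generalize ∑ t, S.len t q p = g₁ at *
  generalize ∑ t, S.len t p q = g₂ at *
  generalize Fintype.card ι = l at *
  obtain ⟨m, rfl⟩ : ∃ m, k = m + 1 := ⟨k - 1, by omega⟩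
  -- The weight `m = k - 1` vanishes when `k = 1`, where the cut with two failed nodes is
  -- unavailable.
  have havg3 : m * ((m + 2) * (2 * l)) ≤ m * (3 * (B₁ + B₂)) := by
    rcases Nat.eq_zero_or_pos m with rfl | hm
    · simp
    · exact Nat.mul_le_mul_left m (by simpa using havg2 (by omega))
  -- After scaling by `k + 1 = m + 2`, the claim is `3 * havg1 + havg3`.
  refine le_of_mul_le_mul_left (a := m + 2) ?_ (by omega)
  nlinarith [havg1, havg3]

end CoopMSR

theorem mainTheorem3 {F : Type*} [Field F] [Fintype F] (n k : ℕ) (hk : 1 ≤ k) (hkn : k ≤ n)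
    (hF : 2 * n ≤ Fintype.card F) :
    (∃ lam : Fin n → Fin 2 → F, Function.Injective (Function.uncurry lam)) ∧
    ∀ lam : Fin n → Fin 2 → F, Function.Injective (Function.uncurry lam) →
      Fintype.card (Fin 3 × (Fin n → Fin 2)) = 3 * 2 ^ n ∧
      (∀ c : Fin n → (Fin 3 × (Fin n → Fin 2)) → F,
        c ∈ CoopMSR.code lam k ↔
          ∀ b : Fin 3, (fun i a => c i (b, a)) ∈ CoopMSR.yeBargCode lam k) ∧
      CoopMSR.IsMSR (CoopMSR.code lam k : Set (Fin n → (Fin 3 × (Fin n → Fin 2)) → F))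
        k 2 (k + 1) ∧
      ∀ 𝓕 𝓡 : Finset (Fin n), Disjoint 𝓕 𝓡 → 𝓕.card = 2 → 𝓡.card = k + 1 →
        CoopMSR.Nco (CoopMSR.code lam k : Set (Fin n → (Fin 3 × (Fin n → Fin 2)) → F)) 𝓕 𝓡
            = 2 * (k + 2) * 2 ^ n ∧
        ∃ S : CoopMSR.RepairScheme
            (CoopMSR.code lam k : Set (Fin n → (Fin 3 × (Fin n → Fin 2)) → F)) 𝓕 𝓡 2,
          S.bandwidth = 2 * (k + 2) * 2 ^ n := by
  refine ⟨?_, fun lam hlam => ?_⟩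
  · obtain ⟨e⟩ : Nonempty (Fin n × Fin 2 ↪ F) :=
      Function.Embedding.nonempty_of_card_le (by simpa [mul_comm] using hF)
    exact ⟨fun i x => e (i, x), fun x y h => e.injective h⟩
  have hl : Fintype.card (Fin 3 × (Fin n → Fin 2)) = 3 * 2 ^ n := by simp
  have hMDS := CoopMSR.isMDS_code hlam hkn
  have hmain : ∀ 𝓕 𝓡 : Finset (Fin n), Disjoint 𝓕 𝓡 → 𝓕.card = 2 → 𝓡.card = k + 1 →
      CoopMSR.Nco (CoopMSR.code lam k : Set (Fin n → (Fin 3 × (Fin n → Fin 2)) → F)) 𝓕 𝓡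
          = 2 * (k + 2) * 2 ^ n ∧
      ∃ S : CoopMSR.RepairScheme
          (CoopMSR.code lam k : Set (Fin n → (Fin 3 × (Fin n → Fin 2)) → F)) 𝓕 𝓡 2,
        S.bandwidth = 2 * (k + 2) * 2 ^ n := by
    intro 𝓕 𝓡 hd h2 hR
    obtain ⟨p, q, hpq, rfl⟩ := Finset.card_eq_two.mp h2
    have hband := CoopMSR.scheme_bandwidth hlam hpq hR hd
    refine ⟨le_antisymm (Nat.sInf_le ⟨2, _, hband⟩) ?_, _, hband⟩
    refine le_csInf ⟨_, 2, _, hband⟩ ?_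
    rintro _ ⟨T, S, rfl⟩
    have := S.cutSet_bound hk hMDS hpq hR hd
    rw [hl] at this
    linarith
  refine ⟨hl, fun c => ?_, ⟨hMDS, fun 𝓕 𝓡 hd h2 hR => ?_⟩, hmain⟩
  · exact ⟨fun h b t ht a => h t ht b a, fun h t ht b a => h b t ht a⟩
  · obtain ⟨hN, S, hS⟩ := hmain 𝓕 𝓡 hd h2 hR
    refine ⟨⟨_, 2, S, hS⟩, ?_⟩
    rw [hN, h2, hR, hl]
    push_cast
    field_simp
    ring
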